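/- Let $k\ge 1$ and let $f:2^\Omega\to\mathbb{R}_{\ge 0}$ be a submodular function with $f(\emptyset)=0$ on a finite ground set $\Omega$, $|\Omega|=n$. Put $\mathrm{OPT}_k(f)=\max\{f(S): S\subseteq\Omega,\ |S|\le k\}$. In the semi-online setting with a $k$-uniform matroid constraint, the elements of $\Omega$ arrive one at a time in uniformly random order. An algorithm (possibly randomized, with no computational restrictions) is told $\Omega$, $n$, $k$ and the value $\mathrm{OPT}_k(f)$ in advance. When an element arrives, the algorithm must decide irrevocably whether to select it. This decision may depend on what the algorithm was told, on its own random bits (which are independent of the arrival order), on the elements that have arrived so far (the current one included) and their order, and on the values of $f$ on all sets of arrived elements. At most $k$ elements may be selected in total. Let $\mathrm{ALG}(f)$ be the set of elements selected by the end. **Theorem.** 1. For $k=2$ and every such algorithm there are a finite set $\Omega$ and a non-negative submodular function $f$ on $2^\Omega$ with $f(\emptyset)=0$ and $\mathrm{OPT}_2(f)>0$ such that $\mathbb{E}[f(\mathrm{ALG}(f))]\le\frac{8}{9}\,\mathrm{OPT}_2(f)$. 2. For every positive even $k$ and every such algorithm there are a finite set $\Omega$ and a non-negative submodular function $f$ on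 $2^\Omega$ with $f(\emptyset)=0$ and $\mathrm{OPT}_k(f)>0$ such that $\mathbb{E}[f(\mathrm{ALG}(f))]\le\frac{17}{18}\,\mathrm{OPT}_k(f)$. The expectation is over the arrival order and the randomness of the algorithm. In particular, no algorithm approximates submodular maximization in this setting within a factor better than $\frac89$ for $k=2$, or better than $\frac{17}{18}$ for any positive even $k$. -/

import Mathlib

open MeasureTheory

/-- A non-negative submodular set function with `f ∅ = 0` on the ground set `Fin n`. -/
structure IsSubmodularFunction {n : ℕ} (f : Finset (Fin n) → ℝ) : Prop where
  empty : f ∅ = 0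
  nonneg : ∀ S, 0 ≤ f S
  submodular : ∀ S T, f (S ∪ T) + f (S ∩ T) ≤ f S + f T

/-- The offline optimum under the `k`-uniform matroid constraint:
the maximum of `f S` over all sets `S` with at most `k` elements. -/
noncomputable def offlineOpt (k : ℕ) {n : ℕ} (f : Finset (Fin n) → ℝ) : ℝ :=
  (Finset.univ.filter fun S : Finset (Fin n) => S.card ≤ k).sup' ⟨∅, by simp⟩ f

/-- A (computationally unbounded, randomized) semi-online algorithm whose random seed lives in
`Seed`. The decision about the element that has just arrived may depend arbitrarily on

* the cardinality bound `k`, the number `n` of elements and the value `opt` of the offline optimum;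
* the random seed;
* the list of the elements that have arrived so far, the most recent one (the one to be decided
  about) first;
* the value oracle for the elements that have arrived so far.

The past decisions of the algorithm are determined by these data. -/
structure SemiOnlineAlgorithm (Seed : Type*) [MeasurableSpace Seed] where
  accept : (k n : ℕ) → (opt : ℝ) → Seed → List (Fin n) → (Finset (Fin n) → ℝ) → Bool
  measurable_accept : ∀ (k n : ℕ) (opt : ℝ) (history : List (Fin n))
    (oracle : Finset (Fin n) → ℝ),
    Measurable fun s : Seed => accept k n opt s history oracle

namespace SemiOnlineAlgorithm

variable {Seed : Type*} [MeasurableSpace Seed]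

/-- What the value oracle shows once the elements of `arrived` have arrived: the values of `f` on
subsets of `arrived`, and nothing else. -/
def revealed {n : ℕ} (f : Finset (Fin n) → ℝ) (arrived : List (Fin n)) :
    Finset (Fin n) → ℝ :=
  fun T => f (T ∩ arrived.toFinset)

/-- The set selected after the arrivals in a list (most recent first). Decisions are irrevocable,
and at most `k` elements can be selected. -/
noncomputable def selected (A : SemiOnlineAlgorithm Seed) (k : ℕ) {n : ℕ}
    (f : Finset (Fin n) → ℝ) (s : Seed) : List (Fin n) → Finset (Fin n)
  | [] => ∅
  | e :: past =>
      if (A.selected k f s past).card < k ∧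
          A.accept k n (offlineOpt k f) s (e :: past) (revealed f (e :: past)) = true
      then insert e (A.selected k f s past)
      else A.selected k f s past

/-- The set selected at the end, when the elements arrive in the order `σ 0, σ 1, …, σ (n - 1)`. -/
noncomputable def output (A : SemiOnlineAlgorithm Seed) (k : ℕ) {n : ℕ}
    (f : Finset (Fin n) → ℝ) (s : Seed) (σ : Equiv.Perm (Fin n)) : Finset (Fin n) :=
  A.selected k f s (List.ofFn σ).reverse

/-- The expected value of the selected set, over the random seed with law `μ` and an independent
uniformly random arrival order. -/
noncomputable def expectedValue (A : SemiOnlineAlgorithm Seed) (μ : Measure Seed) (k : ℕ) {n : ℕ}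
    (f : Finset (Fin n) → ℝ) : ℝ :=
  (∑ σ : Equiv.Perm (Fin n), ∫ s, f (A.output k f s σ) ∂μ) / (n.factorial : ℝ)

end SemiOnlineAlgorithm

/-! The hard instance is a disjoint sum of `m` triples, each with a hidden bad element `c g`, under
the bound `2 * m`. The optimum is `2 * m` for every `c`, so announcing it reveals nothing. All
singletons of a triple are worth `1`, so the decision on its first arrival `x` cannot depend on
whether `x` is bad. If `x` is accepted, the triple yields at most `1` for one of the three bad
elements and `2` for the others; if rejected, at most `1` for two of them. So a triple yields at
most `5/3` on average over `c`, for each seed and each arrival order, and some `c` holds the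
algorithm to `5/6` of the optimum. This is below both `8/9` and `17/18`. The core is
`sum_triangleValue_selected_le`. -/

/-- The value, on three elements, of the set `T` when `c` is the bad element: the pair avoiding `c`
is worth `2`, every other nonempty set is worth `1`. -/
def triangleValue (c : Fin 3) (T : Finset (Fin 3)) : ℕ :=
  if T = ∅ then 0 else if T = Finset.univ.erase c then 2 else 1

lemma triangleValue_submodular : ∀ (c : Fin 3) (S T : Finset (Fin 3)),
    triangleValue c (S ∪ T) + triangleValue c (S ∩ T) ≤ triangleValue c S + triangleValue c T := by
  decide

lemma triangleValue_le_card : ∀ (c : Fin 3) (T : Finset (Fin 3)),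
    triangleValue c T ≤ T.card := by
  decide

lemma triangleValue_le_two (c : Fin 3) (T : Finset (Fin 3)) : triangleValue c T ≤ 2 := by
  unfold triangleValue
  split_ifs <;> simp

lemma triangleValue_erase : ∀ c : Fin 3, triangleValue c (Finset.univ.erase c) = 2 := by
  decide

/-- A set that contains `i` is worth at most `1` if `i` is bad, and a set that omits `i` is worth at
most `1` if `i` is not bad. -/
lemma triangleValue_le_of_mem_iff (c i : Fin 3) (T : Finset (Fin 3)) (h : i ∈ T ↔ c = i) :
    triangleValue c T ≤ 1 := by
  revert c i T
  decide

lemma triangleValue_congr_of_subset_singleton (c c' i : Fin 3) (T : Finset (Fin 3))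
    (h : T ⊆ {i}) : triangleValue c T = triangleValue c' T := by
  revert c c' i T
  decide

/-! ### Disjoint sums of triangles and their optimum -/

/-- The trace of a set on the `g`-th triple of the ground set. -/
def triple {m : ℕ} (g : Fin m) (S : Finset (Fin (m * 3))) : Finset (Fin 3) :=
  Finset.univ.filter fun i => finProdFinEquiv (g, i) ∈ S

@[simp] lemma mem_triple {m : ℕ} {g : Fin m} {S : Finset (Fin (m * 3))} {i : Fin 3} :
    i ∈ triple g S ↔ finProdFinEquiv (g, i) ∈ S := by
  simp [triple]

lemma triple_union {m : ℕ} (g : Fin m) (S T : Finset (Fin (m * 3))) :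
    triple g (S ∪ T) = triple g S ∪ triple g T := by
  ext; simp

lemma triple_inter {m : ℕ} (g : Fin m) (S T : Finset (Fin (m * 3))) :
    triple g (S ∩ T) = triple g S ∩ triple g T := by
  ext; simp

lemma sum_card_triple {m : ℕ} (S : Finset (Fin (m * 3))) :
    ∑ g, (triple g S).card = S.card := by
  have h : S.card = ∑ x, if x ∈ S then 1 else 0 := by simp
  rw [h, ← finProdFinEquiv.sum_comp, Fintype.sum_prod_type]
  simp [triple]

/-- The sum of `m` disjoint triangles, with bad elements given by `c`. -/
def trianglesValue {m : ℕ} (c : Fin m → Fin 3) (S : Finset (Fin (m * 3))) : ℝ :=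
  ((∑ g, triangleValue (c g) (triple g S) : ℕ) : ℝ)

lemma isSubmodularFunction_trianglesValue {m : ℕ} (c : Fin m → Fin 3) :
    IsSubmodularFunction (trianglesValue c) where
  empty := by simp [trianglesValue, triple, triangleValue]
  nonneg _ := Nat.cast_nonneg _
  submodular S T := by
    unfold trianglesValue
    norm_cast
    rw [← Finset.sum_add_distrib, ← Finset.sum_add_distrib]
    refine Finset.sum_le_sum fun g _ => ?_
    rw [triple_union, triple_inter]
    exact triangleValue_submodular _ _ _

lemma trianglesValue_le_card {m : ℕ} (c : Fin m → Fin 3) (S : Finset (Fin (m * 3))) :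
    trianglesValue c S ≤ S.card := by
  unfold trianglesValue
  rw [← sum_card_triple S]
  exact_mod_cast Finset.sum_le_sum fun g _ => triangleValue_le_card _ _

lemma offlineOpt_trianglesValue {m : ℕ} (c : Fin m → Fin 3) :
    offlineOpt (2 * m) (trianglesValue c) = 2 * m := by
  apply le_antisymm
  · refine Finset.sup'_le _ _ fun S hS => (trianglesValue_le_card c S).trans ?_
    exact_mod_cast (Finset.mem_filter.1 hS).2
  -- All good elements: two from each triple, each pair worth `2`.
  · let S : Finset (Fin (m * 3)) :=
      Finset.univ.filter fun x => (finProdFinEquiv.symm x).2 ≠ c (finProdFinEquiv.symm x).1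
    have hS : ∀ g, triple g S = Finset.univ.erase (c g) := by
      intro g
      ext i
      rw [mem_triple]
      simp only [S, Finset.mem_filter, Equiv.symm_apply_apply]
      simp
    have hcard : S.card = 2 * m := by
      rw [← sum_card_triple]
      simp [hS, mul_comm]
    have hval : trianglesValue c S = 2 * m := by
      simp [trianglesValue, hS, triangleValue_erase, mul_comm]
    rw [← hval]
    exact Finset.le_sup' (trianglesValue c) (by simp [hcard])

/-- Exactly one `j` has `a + j = i`, so the sum is `1 + 2 + 2` if `D` holds and `2 + 1 + 1`
otherwise. Here `D` stands for accepting the first arrival of a triple. -/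
lemma sum_ite_iff_le (D : Prop) [Decidable D] (a i : Fin 3) :
    ∑ j : Fin 3, (if (D ↔ a + j = i) then 1 else 2) ≤ 5 := by
  by_cases hD : D
  · simp only [hD, true_iff]
    revert a i
    decide
  · simp only [hD, false_iff]
    revert a i
    decide

/-- Histories list the most recent arrival first, so the last `x` in the list satisfying `p` is the
earliest to arrive. -/
lemma exists_append_cons_of_exists_mem {α : Type*} (p : α → Prop) (l : List α)
    (h : ∃ x ∈ l, p x) :
    ∃ (l₁ : List α) (x : α) (l₂ : List α), l = l₁ ++ x :: l₂ ∧ p x ∧ ∀ y ∈ l₂, ¬ p y := by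
  induction l with
  | nil => simp at h
  | cons a l ih =>
    by_cases hl : ∃ x ∈ l, p x
    · obtain ⟨l₁, x, l₂, rfl, hx, h₂⟩ := ih hl
      exact ⟨a :: l₁, x, l₂, rfl, hx, h₂⟩
    · push Not at hl
      obtain ⟨x, hx, hpx⟩ := h
      rcases List.mem_cons.1 hx with rfl | hx
      · exact ⟨[], x, l, rfl, hpx, hl⟩
      · exact absurd hpx (hl x hx)

/-! ### What the algorithm can know, and averaging over the bad elements -/

namespace SemiOnlineAlgorithm

variable {Seed : Type*} [MeasurableSpace Seed]

/-- The selection depends only on the optimum and on the values of sets of arrived elements. -/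
lemma selected_congr (A : SemiOnlineAlgorithm Seed) (k : ℕ) {n : ℕ} {f f' : Finset (Fin n) → ℝ}
    (hopt : offlineOpt k f = offlineOpt k f') (s : Seed) (l : List (Fin n))
    (h : ∀ T ⊆ l.toFinset, f T = f' T) : A.selected k f s l = A.selected k f' s l := by
  induction l with
  | nil => rfl
  | cons e l ih =>
    have hr : revealed f (e :: l) = revealed f' (e :: l) :=
      funext fun T => h _ Finset.inter_subset_right
    have hl := ih fun T hT => h T (hT.trans (by simp [List.toFinset_cons]))
    simp only [selected, hl, hopt, hr]

/-- Irrevocability: the arrivals in `l₁` come after those in `l₂` and cannot change the fate of an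
element outside `l₁`. -/
lemma mem_selected_append_iff (A : SemiOnlineAlgorithm Seed) (k : ℕ) {n : ℕ}
    (f : Finset (Fin n) → ℝ) (s : Seed) {x : Fin n} (l₁ l₂ : List (Fin n)) (hx : x ∉ l₁) :
    x ∈ A.selected k f s (l₁ ++ l₂) ↔ x ∈ A.selected k f s l₂ := by
  induction l₁ with
  | nil => rfl
  | cons e l ih =>
    simp only [List.mem_cons, not_or] at hx
    rw [List.cons_append, selected]
    split_ifs
    · rw [Finset.mem_insert, ih hx.2, or_iff_right hx.1]
    · exact ih hx.2

lemma measurable_selected (A : SemiOnlineAlgorithm Seed) (k : ℕ) {n : ℕ}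
    (f : Finset (Fin n) → ℝ) (l : List (Fin n)) :
    @Measurable _ _ _ ⊤ fun s => A.selected k f s l := by
  let _ : MeasurableSpace (Finset (Fin n)) := ⊤
  induction l with
  | nil => exact measurable_const
  | cons e l ih =>
    simp only [selected]
    refine Measurable.ite ?_ ((measurable_from_top (f := insert e)).comp ih) ih
    refine MeasurableSet.inter (s₁ := {s | (A.selected k f s l).card < k}) ?_ ?_
    · exact ih (t := {S | S.card < k}) trivial
    · exact A.measurable_accept k n _ _ _ (measurableSet_singleton true)

/-- Over the three choices of the bad element of the `g`-th triple, the algorithm gets at most `5`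
from this triple. -/
lemma sum_triangleValue_selected_le (A : SemiOnlineAlgorithm Seed) {m : ℕ} (s : Seed)
    (l : List (Fin (m * 3))) (hnd : l.Nodup) (hl : ∀ x, x ∈ l) (c : Fin m → Fin 3) (g : Fin m) :
    ∑ j : Fin 3, triangleValue ((c + Pi.single g j : Fin m → Fin 3) g)
      (triple g (A.selected (2 * m) (trianglesValue (c + Pi.single g j)) s l)) ≤ 5 := by
  -- `x` is the first arrival of triple `g`: its past `l₂` contains no element of that triple.
  obtain ⟨l₁, x, l₂, rfl, ⟨i, rfl⟩, h₂⟩ := exists_append_cons_of_exists_mem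
    (fun x => ∃ i, x = finProdFinEquiv (g, i)) l ⟨finProdFinEquiv (g, 0), hl _, 0, rfl⟩
  set x := finProdFinEquiv (g, i) with hx
  have hx₁ : x ∉ l₁ := fun h =>
    (List.nodup_append.1 hnd).2.2 x h x List.mem_cons_self rfl
  -- Whether `x` is selected does not depend on `j`: sets of elements arrived so far meet triple `g`
  -- in at most `{i}`, where the bad element does not show.
  have hmem : ∀ j : Fin 3,
      i ∈ triple g (A.selected (2 * m) (trianglesValue (c + Pi.single g j)) s (l₁ ++ x :: l₂)) ↔
        x ∈ A.selected (2 * m) (trianglesValue c) s (x :: l₂) := by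
    intro j
    rw [mem_triple, ← hx, A.mem_selected_append_iff _ _ _ _ _ hx₁,
      A.selected_congr (2 * m) (f' := trianglesValue c)]
    · rw [offlineOpt_trianglesValue, offlineOpt_trianglesValue]
    · intro T hT
      unfold trianglesValue
      congr 1
      refine Finset.sum_congr rfl fun h _ => ?_
      by_cases hg : h = g
      · subst hg
        refine triangleValue_congr_of_subset_singleton _ _ i _ fun i' hi' => ?_
        have := hT (mem_triple.1 hi')
        rw [List.mem_toFinset, List.mem_cons] at this
        rcases this with h' | h'
        · simpa [hx] using h'
        · exact absurd ⟨i', rfl⟩ (h₂ _ h')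
      · simp [hg]
  classical
  refine (Finset.sum_le_sum fun j _ => ?_).trans
    (sum_ite_iff_le (x ∈ A.selected (2 * m) (trianglesValue c) s (x :: l₂)) (c g) i)
  split_ifs with h
  · refine triangleValue_le_of_mem_iff _ i _ ((hmem j).trans ?_)
    simpa using h
  · exact triangleValue_le_two _ _

lemma sum_trianglesValue_selected_le (A : SemiOnlineAlgorithm Seed) {m : ℕ} (s : Seed)
    (l : List (Fin (m * 3))) (hnd : l.Nodup) (hl : ∀ x, x ∈ l) :
    ∑ c : Fin m → Fin 3, trianglesValue c (A.selected (2 * m) (trianglesValue c) s l) ≤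
      ∑ _c : Fin m → Fin 3, (5 / 3 * m : ℝ) := by
  have h : ∀ g : Fin m, 3 * ∑ c : Fin m → Fin 3, triangleValue (c g)
      (triple g (A.selected (2 * m) (trianglesValue c) s l)) ≤ ∑ _c : Fin m → Fin 3, 5 := by
    intro g
    calc _ = ∑ j : Fin 3, ∑ c : Fin m → Fin 3,
          triangleValue ((c + Pi.single g j : Fin m → Fin 3) g)
            (triple g (A.selected (2 * m) (trianglesValue (c + Pi.single g j)) s l)) := by
          -- Translation by `Pi.single g j` permutes the choices of `c`, so each of the three values
          -- of `j` contributes the same sum.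
          refine Eq.symm ((Finset.sum_congr rfl fun j _ =>
            Equiv.sum_comp (Equiv.addRight (Pi.single g j)) fun c : Fin m → Fin 3 =>
              triangleValue (c g)
                (triple g (A.selected (2 * m) (trianglesValue c) s l))).trans ?_)
          simp
      _ ≤ _ := by
          rw [Finset.sum_comm]
          exact Finset.sum_le_sum fun c _ => A.sum_triangleValue_selected_le s l hnd hl c g
  have hsum := Finset.sum_le_sum fun g (_ : g ∈ Finset.univ) => h g
  rw [← Finset.mul_sum, Finset.sum_comm] at hsum
  have hreal : (3 : ℝ) * ∑ c : Fin m → Fin 3,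
      trianglesValue c (A.selected (2 * m) (trianglesValue c) s l) ≤
        ∑ _g : Fin m, ∑ _c : Fin m → Fin 3, 5 := by
    unfold trianglesValue
    exact_mod_cast hsum
  simp only [Finset.sum_const, nsmul_eq_mul, Finset.card_univ, Fintype.card_fin] at hreal ⊢
  linarith

theorem exists_expectedValue_le (A : SemiOnlineAlgorithm Seed) (μ : Measure Seed)
    [IsProbabilityMeasure μ] (m : ℕ) :
    ∃ c : Fin m → Fin 3,
      A.expectedValue μ (2 * m) (trianglesValue c) ≤ 5 / 3 * m := by
  suffices h : ∑ c : Fin m → Fin 3, A.expectedValue μ (2 * m) (trianglesValue c) ≤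
      ∑ _c : Fin m → Fin 3, (5 / 3 * m : ℝ) by
    obtain ⟨c, -, hc⟩ := Finset.exists_le_of_sum_le Finset.univ_nonempty h
    exact ⟨c, hc⟩
  have hint : ∀ (σ : Equiv.Perm (Fin (m * 3))) (c : Fin m → Fin 3),
      Integrable (fun s => trianglesValue c (A.output (2 * m) (trianglesValue c) s σ)) μ := by
    intro σ c
    let _ : MeasurableSpace (Finset (Fin (m * 3))) := ⊤
    -- The value is bounded by the size `m * 3` of the ground set.
    refine Integrable.of_bound (C := (m * 3 : ℕ)) (((measurable_from_top
      (f := trianglesValue c)).comp (A.measurable_selected _ _ _)).aestronglyMeasurable) ?_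
    refine Filter.Eventually.of_forall fun s => ?_
    rw [Real.norm_of_nonneg ((isSubmodularFunction_trianglesValue c).nonneg _)]
    refine (trianglesValue_le_card _ _).trans ?_
    exact_mod_cast (Finset.card_le_univ _).trans (by simp)
  have hσ : ∀ σ : Equiv.Perm (Fin (m * 3)), ∑ c : Fin m → Fin 3,
      ∫ s, trianglesValue c (A.output (2 * m) (trianglesValue c) s σ) ∂μ ≤
        ∑ _c : Fin m → Fin 3, (5 / 3 * m : ℝ) := by
    intro σ
    rw [← integral_finsetSum _ fun c _ => hint σ c]
    refine (integral_mono (integrable_finsetSum _ fun c _ => hint σ c) (integrable_const _)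
      fun s => A.sum_trianglesValue_selected_le s _ ?_ ?_).trans ?_
    · exact List.nodup_reverse.2 (List.nodup_ofFn.2 σ.injective)
    · intro x
      rw [List.mem_reverse, List.mem_ofFn]
      exact σ.surjective x
    · simp
  simp only [expectedValue]
  rw [← Finset.sum_div, Finset.sum_comm, div_le_iff₀ (by positivity)]
  refine (Finset.sum_le_sum fun σ _ => hσ σ).trans (le_of_eq ?_)
  rw [Finset.sum_const, Finset.card_univ, Fintype.card_perm, Fintype.card_fin, nsmul_eq_mul,
    mul_comm]

end SemiOnlineAlgorithm

theorem mainTheorem11 {Seed : Type*} [MeasurableSpace Seed] (μ : Measure Seed)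
    [IsProbabilityMeasure μ] (A : SemiOnlineAlgorithm Seed) :
    (∃ (n : ℕ) (f : Finset (Fin n) → ℝ), IsSubmodularFunction f ∧
      0 < offlineOpt 2 f ∧ A.expectedValue μ 2 f ≤ 8 / 9 * offlineOpt 2 f) ∧
    (∀ k : ℕ, 0 < k → Even k →
      ∃ (n : ℕ) (f : Finset (Fin n) → ℝ), IsSubmodularFunction f ∧
        0 < offlineOpt k f ∧ A.expectedValue μ k f ≤ 17 / 18 * offlineOpt k f) := by

  -- The threshold is `5/6 = (5/3 * m) / (2 * m)`.
  have main : ∀ m : ℕ, 0 < m → ∀ r : ℝ, 5 / 6 ≤ r →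
      ∃ (n : ℕ) (f : Finset (Fin n) → ℝ), IsSubmodularFunction f ∧
        0 < offlineOpt (2 * m) f ∧
          A.expectedValue μ (2 * m) f ≤ r * offlineOpt (2 * m) f := by
    intro m hm r hr
    obtain ⟨c, hc⟩ := A.exists_expectedValue_le μ m
    have hm' : (0 : ℝ) < m := by exact_mod_cast hm
    refine ⟨m * 3, trianglesValue c, isSubmodularFunction_trianglesValue c, ?_, ?_⟩
    · rw [offlineOpt_trianglesValue]
      positivity
    · rw [offlineOpt_trianglesValue]
      nlinarith
  refine ⟨main 1 one_pos _ (by norm_num), fun k hk hk2 => ?_⟩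
  obtain ⟨m, rfl⟩ := hk2.two_dvd
  exact main m (by omega) _ (by norm_num)
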